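/- \textbf{Setting.} Let $(\bar M,\bar g)$ be an $(m+n)$-dimensional smooth semi-Riemannian manifold of constant index with Levi-Civita connection $\bar\nabla$, and let $\bar J$ be a metallic structure on it: a smooth $(1,1)$-tensor field with $\bar J^2=p\bar J+qI$ for positive integers $p,q$ and $\bar g(U,\bar JV)=\bar g(\bar JU,V)$ for all $U,V$. Let $\eta$ be a smooth vector field on $\bar M$, let $\pi(U)=\bar g(U,\eta)$, and let $\bar D$ be the quarter symmetric non-metric connection $\bar D_UV=\bar\nabla_UV+\pi(V)\bar JU$. Let $M$ be an $m$-dimensional (immersed) $r$-lightlike submanifold of $\bar M$, i.e. $\mathrm{Rad}(TM)=TM\cap TM^{\perp}$ is a smooth distribution of constant rank $r>0$. Fix a screen distribution $S(TM)$, so $TM=\mathrm{Rad}(TM)\perp S(TM)$; a screen transversal bundle $S(TM^\perp)$, so $TM^{\perp}=\mathrm{Rad}(TM)\perp S(TM^\perp)$; and a lightlike transversal bundle $\mathrm{ltr}(TM)$, that is, a totally null smooth subbundle of rank $r$ complementary to $\mathrm{Rad}(TM)$ in the orthogonal complement of $S(TM)\perp S(TM^\perp)$ in $T\bar M|_M$.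 Then $T\bar M|_M=TM\oplus \mathrm{ltr}(TM)\oplus S(TM^{\perp})$. For $U\in\Gamma(TM)$ and with respect to this decomposition, let $D_UV$ and $\bar h^s(U,V)$ be the components in $TM$ and in $S(TM^\perp)$ of $\bar D_UV$ for $V\in\Gamma(TM)$, and let $\bar D^s(U,N)$ be the component in $S(TM^{\perp})$ of $\bar D_UN$ for $N\in\Gamma(\mathrm{ltr}(TM))$. Assume that $M$ is screen semi-invariant: there is a smooth distribution $B\subseteq S(TM)$ such that, $B^{\perp}$ being the orthogonal complement of $B$ in $S(TM)$, one has $S(TM)=B\oplus B^\perp$, $\bar J(B)=B$, $\bar J(B^\perp)\subseteq S(TM^\perp)$, $\bar J(\mathrm{Rad}(TM))=\mathrm{Rad}(TM)$ and $\bar J(\mathrm{ltr}(TM))=\mathrm{ltr}(TM)$. Assume moreover that $(\bar\nabla_U\bar J)V=0$ for all $U,V\in\Gamma(TM)$ (in particular this holds if $\bar\nabla\bar J=0$); equivalently, \[\bar D_U\bar JV=\bar J\bar D_UV-p\,\pi(V)\bar JU-q\,\pi(V)U+\pi(\bar JV)\bar JU\qquad (U,V\in\Gamma(TM)).\] \textbf{Theorem.}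 The distribution $B^\perp$ defines a totally geodesic foliation on $M$ with respect to the induced connection $D$, that is, $D_UV\in\Gamma(B^{\perp})$ for all $U,V\in\Gamma(B^\perp)$, if and only if both of the following hold: \[\bar g(\bar h^s(U,\bar JZ),\bar JV)=\pi(\bar JZ)\,\bar g(\bar JU,\bar JV)\quad\text{for all } U,V\in\Gamma(B^\perp),\ Z\in\Gamma(B),\] \[\bar g(\bar D^s(U,\bar JN),\bar JV)=\pi(\bar JN)\,\bar g(\bar JU,\bar JV)\quad\text{for all } U,V\in\Gamma(B^\perp),\ N\in\Gamma(\mathrm{ltr}(TM)).\] -/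

import Mathlib

open Bundle Manifold Topology
open scoped ContDiff

noncomputable section

namespace LightlikeGeometry

/-! Manifolds are `C^∞`, without boundary, modelled on `EuclideanSpace ℝ (Fin d)`. -/

section Ambient

variable {d : ℕ} {N : Type*} [TopologicalSpace N]
  [ChartedSpace (EuclideanSpace ℝ (Fin d)) N] [IsManifold (𝓡 d) ∞ N]

/-- A smooth vector field on a manifold. -/
def IsSmoothVectorField (X : (y : N) → TangentSpace (𝓡 d) y) : Prop :=
  ContMDiff (𝓡 d) (𝓡 d).tangent ∞ (fun y ↦ (⟨y, X y⟩ : TangentBundle (𝓡 d) N))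

/-- A smooth field of endomorphisms of the tangent spaces, i.e. a smooth `(1,1)`-tensor field. -/
def IsSmoothEndomorphismField
    (J : (y : N) → TangentSpace (𝓡 d) y →L[ℝ] TangentSpace (𝓡 d) y) : Prop :=
  ContMDiff (𝓡 d)
    ((𝓡 d).prod 𝓘(ℝ, EuclideanSpace ℝ (Fin d) →L[ℝ] EuclideanSpace ℝ (Fin d))) ∞
    (fun y ↦ TotalSpace.mk' (EuclideanSpace ℝ (Fin d) →L[ℝ] EuclideanSpace ℝ (Fin d))
      (E := fun y : N ↦ TangentSpace (𝓡 d) y →L[ℝ] TangentSpace (𝓡 d) y) y (J y))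

variable (d N) in
/-- A semi-Riemannian metric of constant index on the `d`-dimensional manifold `N`: a smooth field
of symmetric nondegenerate bilinear forms on the tangent spaces, for which the maximal dimension
of a negative definite subspace of a tangent space is the same at all points. -/
structure SemiRiemannianMetric where
  /-- The scalar product on each tangent space. -/
  inner (y : N) : TangentSpace (𝓡 d) y →L[ℝ] TangentSpace (𝓡 d) y →L[ℝ] ℝ
  contMDiff : ContMDiff (𝓡 d)
    ((𝓡 d).prod 𝓘(ℝ, EuclideanSpace ℝ (Fin d) →L[ℝ] EuclideanSpace ℝ (Fin d) →L[ℝ] ℝ)) ∞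
    (fun y ↦ TotalSpace.mk' (EuclideanSpace ℝ (Fin d) →L[ℝ] EuclideanSpace ℝ (Fin d) →L[ℝ] ℝ)
      (E := fun y : N ↦ TangentSpace (𝓡 d) y →L[ℝ] TangentSpace (𝓡 d) y →L[ℝ] ℝ) y (inner y))
  symm (y : N) (v w : TangentSpace (𝓡 d) y) : inner y v w = inner y w v
  nondegenerate (y : N) (v : TangentSpace (𝓡 d) y) : (∀ w, inner y v w = 0) → v = 0
  /-- The index. -/
  index : ℕ
  index_spec (y : N) : IsGreatest
    {k : ℕ | ∃ W : Submodule ℝ (TangentSpace (𝓡 d) y),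
      Module.finrank ℝ W = k ∧ ∀ w ∈ W, w ≠ 0 → inner y w w < 0} index

namespace SemiRiemannianMetric

variable (g : SemiRiemannianMetric d N)

/-- The orthogonal space `Wᗮ` of a subspace `W` of a tangent space. -/
def orth (y : N) (W : Submodule ℝ (TangentSpace (𝓡 d) y)) :
    Submodule ℝ (TangentSpace (𝓡 d) y) where
  carrier := {v | ∀ w ∈ W, g.inner y v w = 0}
  add_mem' := fun {v v'} hv hv' w hw ↦ by simp [hv w hw, hv' w hw]
  zero_mem' := fun w _ ↦ by simp
  smul_mem' := fun c v hv w hw ↦ by simp [hv w hw]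

/-- The scalar product as a bilinear form. -/
def bilin (y : N) : LinearMap.BilinForm ℝ (TangentSpace (𝓡 d) y) :=
  LinearMap.mk₂ ℝ (fun v w ↦ g.inner y v w) (by simp) (by simp) (by simp) (by simp)

theorem orth_eq (y : N) (W : Submodule ℝ (TangentSpace (𝓡 d) y)) :
    g.orth y W = (g.bilin y).orthogonal W := by
  ext v
  simp only [LinearMap.BilinForm.mem_orthogonal_iff]
  exact forall₂_congr fun w _ ↦ by
    rw [g.symm]; rfl

theorem bilin_nondegenerate (y : N) : (g.bilin y).Nondegenerate := by
  refine ⟨fun v hv ↦ g.nondegenerate y v hv, fun v hv ↦ g.nondegenerate y v fun w ↦ ?_⟩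
  rw [g.symm]; exact hv w

theorem bilin_isRefl (y : N) : (g.bilin y).IsRefl := fun v w h ↦ by
  have : g.inner y v w = 0 := h
  rw [g.symm] at this
  exact this

theorem sup_orth_eq_top (y : N) (W : Submodule ℝ (TangentSpace (𝓡 d) y))
    (h : W ⊓ g.orth y W = ⊥) : W ⊔ g.orth y W = ⊤ := by
  have : FiniteDimensional ℝ (TangentSpace (𝓡 d) y) :=
    inferInstanceAs (FiniteDimensional ℝ (EuclideanSpace ℝ (Fin d)))
  rw [orth_eq] at h ⊢
  exact (((g.bilin y).isCompl_orthogonal_iff_disjoint (g.bilin_isRefl y)).2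
    (disjoint_iff.2 h)).sup_eq_top

theorem orth_orth (y : N) (W : Submodule ℝ (TangentSpace (𝓡 d) y)) :
    g.orth y (g.orth y W) ≤ W := by
  have : FiniteDimensional ℝ (TangentSpace (𝓡 d) y) :=
    inferInstanceAs (FiniteDimensional ℝ (EuclideanSpace ℝ (Fin d)))
  rw [orth_eq, orth_eq, LinearMap.BilinForm.orthogonal_orthogonal (g.bilin_nondegenerate y)
    (g.bilin_isRefl y)]

/-- `nabla` is the Levi-Civita connection of `g`: it is torsion free and metric. (In Mathlib's
convention `nabla X y v` is the covariant derivative of `X` at `y` in the direction `v`.) -/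
structure IsLeviCivita
    (nabla : CovariantDerivative (𝓡 d) (EuclideanSpace ℝ (Fin d))
      (TangentSpace (𝓡 d) : N → Type _)) : Prop where
  torsion_eq_zero : nabla.torsion = 0
  metric (y : N) (X Y : (y : N) → TangentSpace (𝓡 d) y)
    (hX : MDifferentiableAt (𝓡 d) (𝓡 d).tangent
      (fun y ↦ (⟨y, X y⟩ : TangentBundle (𝓡 d) N)) y)
    (hY : MDifferentiableAt (𝓡 d) (𝓡 d).tangent
      (fun y ↦ (⟨y, Y y⟩ : TangentBundle (𝓡 d) N)) y)
    (v : TangentSpace (𝓡 d) y) :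
    mvfderiv (𝓡 d) (fun z ↦ g.inner z (X z) (Y z)) y v =
      g.inner y (nabla X y v) (Y y) + g.inner y (X y) (nabla Y y v)

/-- A metallic structure compatible with `g`: a smooth `(1,1)`-tensor field `J` with
`J² = p J + q I` for positive integers `p`, `q`, self-adjoint with respect to `g`. Together
with `g` it makes `N` a metallic semi-Riemannian manifold. -/
structure MetallicStructure (p q : ℕ) where
  /-- The endomorphism of each tangent space. -/
  J (y : N) : TangentSpace (𝓡 d) y →L[ℝ] TangentSpace (𝓡 d) y
  smooth : IsSmoothEndomorphismField J
  p_pos : 0 < p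
  q_pos : 0 < q
  sq (y : N) (v : TangentSpace (𝓡 d) y) : J y (J y v) = (p : ℝ) • J y v + (q : ℝ) • v
  compatible (y : N) (v w : TangentSpace (𝓡 d) y) : g.inner y v (J y w) = g.inner y (J y v) w

/-- The `1`-form `π(V) = g(V, η)` associated with the vector field `η`. -/
def oneForm (η : (y : N) → TangentSpace (𝓡 d) y) (y : N) : TangentSpace (𝓡 d) y →L[ℝ] ℝ :=
  g.inner y (η y)

/-- The quarter symmetric non-metric connection `D_U V = ∇_U V + π(V) J U`, where `π` is the
`1`-form associated with `η`. -/
def quarterSymmetric {p q : ℕ} (S : g.MetallicStructure p q)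
    (nabla : CovariantDerivative (𝓡 d) (EuclideanSpace ℝ (Fin d))
      (TangentSpace (𝓡 d) : N → Type _))
    (η : (y : N) → TangentSpace (𝓡 d) y) :
    CovariantDerivative (𝓡 d) (EuclideanSpace ℝ (Fin d)) (TangentSpace (𝓡 d) : N → Type _) :=
  nabla.addOneForm fun y ↦ (g.oneForm η y).smulRight (S.J y)

end SemiRiemannianMetric

end Ambient

section Along

variable {m d : ℕ} {N : Type*} [TopologicalSpace N]
  [ChartedSpace (EuclideanSpace ℝ (Fin d)) N] [IsManifold (𝓡 d) ∞ N]
  {M : Type*} [TopologicalSpace M]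
  [ChartedSpace (EuclideanSpace ℝ (Fin m)) M] [IsManifold (𝓡 m) ∞ M]

/-- Smoothness of a vector field along `φ : M → N`, that is, of a section of `TN` restricted
to `M`. -/
def IsSmoothAlong (φ : M → N) (X : (x : M) → TangentSpace (𝓡 d) (φ x)) : Prop :=
  ContMDiff (𝓡 m) (𝓡 d).tangent ∞ (fun x ↦ (⟨φ x, X x⟩ : TangentBundle (𝓡 d) N))

/-- `D` is a smooth subbundle of rank `k` of `TN` restricted to `M`: near every point of `M` it
is spanned by `k` smooth pointwise linearly independent vector fields along `φ`. -/
def IsSubbundleAlong (φ : M → N) (D : (x : M) → Submodule ℝ (TangentSpace (𝓡 d) (φ x)))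
    (k : ℕ) : Prop :=
  ∀ x₀ : M, ∃ W ∈ 𝓝 x₀, ∃ e : Fin k → (x : M) → TangentSpace (𝓡 d) (φ x),
    (∀ i, ContMDiffOn (𝓡 m) (𝓡 d).tangent ∞
      (fun x ↦ (⟨φ x, e i x⟩ : TangentBundle (𝓡 d) N)) W) ∧
    ∀ x ∈ W, LinearIndependent ℝ (fun i ↦ e i x) ∧
      Submodule.span ℝ (Set.range fun i ↦ e i x) = D x

/-- `X` is a smooth section of `D`, a family of subspaces of the tangent spaces of `N` along
`φ`. -/
def IsSection (φ : M → N) (D : (x : M) → Submodule ℝ (TangentSpace (𝓡 d) (φ x)))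
    (X : (x : M) → TangentSpace (𝓡 d) (φ x)) : Prop :=
  IsSmoothAlong (m := m) φ X ∧ ∀ x, X x ∈ D x

/-- A vector field `U` on `M`, regarded as a vector field along `φ : M → N`. -/
def push (φ : M → N) (U : (x : M) → TangentSpace (𝓡 m) x) (x : M) : TangentSpace (𝓡 d) (φ x) :=
  mfderiv (𝓡 m) (𝓡 d) φ x (U x)

/-- `U` is a smooth vector field on `M` with values in the distribution `D` on `M`, where `D` is
given as a family of subspaces of the tangent spaces of `N` along `φ`. -/
def IsTangentSection (φ : M → N) (D : (x : M) → Submodule ℝ (TangentSpace (𝓡 d) (φ x)))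
    (U : (x : M) → TangentSpace (𝓡 m) x) : Prop :=
  IsSmoothVectorField U ∧ ∀ x, push φ U x ∈ D x

/-- The tangent space of `M` as a subspace of the tangent space of `N`. -/
def tangent (φ : M → N) (x : M) : Submodule ℝ (TangentSpace (𝓡 d) (φ x)) :=
  LinearMap.range (mfderiv (𝓡 m) (𝓡 d) φ x : TangentSpace (𝓡 m) x →ₗ[ℝ] TangentSpace (𝓡 d) (φ x))

/-- The covariant derivative `∇_U X` of a vector field `X` along `φ : M → N` in the direction of a
vector field `U` on `M`, for a connection `∇` on `N` (i.e. the pull-back connection). In the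
standard local frame `E_a` of `TN` around `φ x`, with `X = ∑ X^a E_a`, it is
`∑ (d X^a (U) E_a + X^a ∇_{dφ U} E_a)`; the second sum is the covariant derivative of the field
with constant coefficients `X^a(x)`, which is `FiberBundle.extend _ (X x)`. -/
def covAlong (nabla : CovariantDerivative (𝓡 d) (EuclideanSpace ℝ (Fin d))
      (TangentSpace (𝓡 d) : N → Type _))
    (φ : M → N) (U : (x : M) → TangentSpace (𝓡 m) x) (X : (x : M) → TangentSpace (𝓡 d) (φ x))
    (x : M) : TangentSpace (𝓡 d) (φ x) :=
  (trivializationAt (EuclideanSpace ℝ (Fin d)) (TangentSpace (𝓡 d) : N → Type _) (φ x)).symm (φ x)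
      (mvfderiv (𝓡 m) (fun z ↦ (trivializationAt (EuclideanSpace ℝ (Fin d))
        (TangentSpace (𝓡 d) : N → Type _) (φ x) ⟨φ z, X z⟩).2) x (U x)) +
    nabla (FiberBundle.extend (EuclideanSpace ℝ (Fin d)) (X x)) (φ x) (push φ U x)

namespace SemiRiemannianMetric

/-- The radical distribution `Rad TM = TM ∩ TMᗮ` of `M`. -/
def radical (g : SemiRiemannianMetric d N) (φ : M → N) (x : M) :
    Submodule ℝ (TangentSpace (𝓡 d) (φ x)) :=
  tangent (m := m) φ x ⊓ g.orth (φ x) (tangent (m := m) φ x)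

/-- `(∇_U J) V = 0` for all vector fields `U`, `V` tangent to `M`. -/
def MetallicStructure.IsParallelAlong {g : SemiRiemannianMetric d N} {p q : ℕ}
    (S : g.MetallicStructure p q)
    (nabla : CovariantDerivative (𝓡 d) (EuclideanSpace ℝ (Fin d))
      (TangentSpace (𝓡 d) : N → Type _)) (φ : M → N) : Prop :=
  ∀ U V : (x : M) → TangentSpace (𝓡 m) x, IsSmoothVectorField U → IsSmoothVectorField V →
    ∀ x, covAlong nabla φ U (fun z ↦ S.J (φ z) (push φ V z)) x =
      S.J (φ x) (covAlong nabla φ U (push φ V) x)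

end SemiRiemannianMetric

/-- A lightlike submanifold `(M, g, S(TM), S(TMᗮ))` of the semi-Riemannian manifold `(N, g)`,
immersed by `φ`, with a lightlike transversal bundle. -/
structure LightlikeSubmanifold (g : SemiRiemannianMetric d N) (φ : M → N) where
  isImmersion : IsImmersion (𝓡 m) (𝓡 d) ∞ φ
  /-- The rank of the radical distribution. -/
  r : ℕ
  r_pos : 0 < r
  isSubbundle_radical : IsSubbundleAlong (m := m) φ (g.radical (m := m) φ) r
  /-- The screen distribution `S(TM)`, a complement of `Rad TM` in `TM`. -/
  screen (x : M) : Submodule ℝ (TangentSpace (𝓡 d) (φ x))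
  isSubbundle_screen : ∃ k, IsSubbundleAlong (m := m) φ screen k
  screen_inf (x : M) : screen x ⊓ g.radical (m := m) φ x = ⊥
  screen_sup (x : M) : screen x ⊔ g.radical (m := m) φ x = tangent (m := m) φ x
  /-- The screen transversal bundle `S(TMᗮ)`, a complement of `Rad TM` in `TMᗮ`. -/
  screenTr (x : M) : Submodule ℝ (TangentSpace (𝓡 d) (φ x))
  isSubbundle_screenTr : ∃ k, IsSubbundleAlong (m := m) φ screenTr k
  screenTr_inf (x : M) : screenTr x ⊓ g.radical (m := m) φ x = ⊥
  screenTr_sup (x : M) :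
    screenTr x ⊔ g.radical (m := m) φ x = g.orth (φ x) (tangent (m := m) φ x)
  /-- The lightlike transversal bundle `ltr(TM)`: a totally null complement of `Rad TM` in the
  orthogonal bundle of `S(TMᗮ)` in `S(TM)ᗮ`. -/
  ltr (x : M) : Submodule ℝ (TangentSpace (𝓡 d) (φ x))
  isSubbundle_ltr : IsSubbundleAlong (m := m) φ ltr r
  ltr_inf (x : M) : ltr x ⊓ g.radical (m := m) φ x = ⊥
  ltr_sup (x : M) : ltr x ⊔ g.radical (m := m) φ x =
    g.orth (φ x) (screen x) ⊓ g.orth (φ x) (screenTr x)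
  ltr_null (x : M) : ∀ v ∈ ltr x, ∀ w ∈ ltr x, g.inner (φ x) v w = 0

namespace LightlikeSubmanifold

variable {g : SemiRiemannianMetric d N} {φ : M → N} (L : LightlikeSubmanifold (m := m) g φ)

theorem sup_eq_top (x : M) : tangent (m := m) φ x ⊔ L.ltr x ⊔ L.screenTr x = ⊤ := by
  have hS := g.sup_orth_eq_top (φ x) (L.screen x) (by
    rw [eq_bot_iff]
    rintro v ⟨hv, hv'⟩
    have hvA : v ∈ tangent (m := m) φ x := L.screen_sup x ▸ Submodule.mem_sup_left hv
    rw [← L.screen_inf x]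
    refine ⟨hv, hvA, fun w hw ↦ ?_⟩
    rw [← L.screen_sup x] at hw
    obtain ⟨s, hs, e, he, rfl⟩ := Submodule.mem_sup.1 hw
    have h1 := hv' s hs
    have h2 := he.2 v hvA
    rw [g.symm] at h2
    simp [h1, h2])
  have hT := g.sup_orth_eq_top (φ x) (L.screenTr x) (by
    rw [eq_bot_iff]
    rintro v ⟨hv, hv'⟩
    have hvA : v ∈ g.orth (φ x) (tangent (m := m) φ x) :=
      L.screenTr_sup x ▸ Submodule.mem_sup_left hv
    rw [← L.screenTr_inf x]
    refine ⟨hv, ?_, hvA⟩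
    refine g.orth_orth (φ x) _ fun w hw ↦ ?_
    rw [← L.screenTr_sup x] at hw
    obtain ⟨s, hs, e, he, rfl⟩ := Submodule.mem_sup.1 hw
    have h1 := hv' s hs
    have h2 := hvA e he.1
    simp [h1, h2])
  rw [eq_top_iff]
  intro v _
  obtain ⟨s, hs, t, ht, rfl⟩ := Submodule.mem_sup.1 (hS ▸ Submodule.mem_top : v ∈ _)
  obtain ⟨w, hw, u, hu, rfl⟩ := Submodule.mem_sup.1 (hT ▸ Submodule.mem_top : t ∈ _)
  have hsA : s ∈ tangent (m := m) φ x := L.screen_sup x ▸ Submodule.mem_sup_left hs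
  have hwS : w ∈ g.orth (φ x) (L.screen x) := fun a ha ↦
    (L.screenTr_sup x ▸ Submodule.mem_sup_left hw : w ∈ g.orth (φ x) (tangent (m := m) φ x)) a
      (L.screen_sup x ▸ Submodule.mem_sup_left ha)
  have huS : u ∈ g.orth (φ x) (L.screen x) := by simpa using sub_mem ht hwS
  have hu' : u ∈ L.ltr x ⊔ g.radical (m := m) φ x := by
    rw [L.ltr_sup x]; exact ⟨huS, hu⟩
  obtain ⟨l, hl, e, he, rfl⟩ := Submodule.mem_sup.1 hu'
  have : s + (w + (l + e)) = ((s + e) + l) + w := by abel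
  rw [this]
  exact add_mem (Submodule.mem_sup_left (add_mem
    (Submodule.mem_sup_left (add_mem hsA he.1)) (Submodule.mem_sup_right hl)))
    (Submodule.mem_sup_right hw)

theorem independent (x : M) {a l w : TangentSpace (𝓡 d) (φ x)}
    (ha : a ∈ tangent (m := m) φ x) (hl : l ∈ L.ltr x) (hw : w ∈ L.screenTr x)
    (h : a + l + w = 0) : a = 0 ∧ l = 0 ∧ w = 0 := by
  rw [← L.screen_sup x] at ha
  obtain ⟨s, hs, e, he, rfl⟩ := Submodule.mem_sup.1 ha
  have hsA : s ∈ tangent (m := m) φ x := L.screen_sup x ▸ Submodule.mem_sup_left hs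
  have hwA : w ∈ g.orth (φ x) (tangent (m := m) φ x) :=
    L.screenTr_sup x ▸ Submodule.mem_sup_left hw
  have hl' : l ∈ g.orth (φ x) (L.screen x) ⊓ g.orth (φ x) (L.screenTr x) :=
    L.ltr_sup x ▸ Submodule.mem_sup_left hl
  have hs0 : s = 0 := by
    have : s ∈ L.screen x ⊓ g.radical (m := m) φ x := by
      refine ⟨hs, hsA, fun b hb ↦ ?_⟩
      have hbA := hb
      rw [← L.screen_sup x] at hb
      obtain ⟨s', hs', e', he', rfl⟩ := Submodule.mem_sup.1 hb
      have hs'A : s' ∈ tangent (m := m) φ x := L.screen_sup x ▸ Submodule.mem_sup_left hs'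
      have h0 := congrArg (fun v ↦ g.inner (φ x) v s') h
      have h1 := he.2 s' hs'A
      have h2 := hl'.1 s' hs'
      have h3 := hwA s' hs'A
      have h4 := he'.2 s hsA
      rw [g.symm] at h4
      simp [h1, h2, h3] at h0
      simp [h0, h4]
    rw [L.screen_inf x] at this
    simpa using this
  subst hs0
  have hw0 : w = 0 := by
    have : w ∈ L.screenTr x ⊓ g.radical (m := m) φ x := by
      refine ⟨hw, g.orth_orth (φ x) _ fun b hb ↦ ?_, hwA⟩
      rw [← L.screenTr_sup x] at hb
      obtain ⟨w', hw', e', he', rfl⟩ := Submodule.mem_sup.1 hb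
      have hw'A : w' ∈ g.orth (φ x) (tangent (m := m) φ x) :=
        L.screenTr_sup x ▸ Submodule.mem_sup_left hw'
      have h0 := congrArg (fun v ↦ g.inner (φ x) v w') h
      have h1 := hw'A e he.1
      rw [g.symm] at h1
      have h2 := hl'.2 w' hw'
      have h3 := hwA e' he'.1
      simp [h1, h2] at h0
      simp [h0, h3]
    rw [L.screenTr_inf x] at this
    simpa using this
  subst hw0
  have hl0 : l = 0 := by
    have : l ∈ L.ltr x ⊓ g.radical (m := m) φ x := by
      refine ⟨hl, ?_⟩
      have : l = -e := by
        have := h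
        simp only [zero_add, add_zero] at this
        exact (neg_eq_of_add_eq_zero_right this).symm
      rw [this]
      exact neg_mem he
    rw [L.ltr_inf x] at this
    simpa using this
  subst hl0
  simpa using h

/-- `TN = TM ⊕ tr(TM)` along `M`, where `tr(TM) = ltr(TM) ⊕ S(TMᗮ)`. -/
theorem isCompl_tangent (x : M) : IsCompl (tangent (m := m) φ x) (L.ltr x ⊔ L.screenTr x) := by
  refine ⟨Submodule.disjoint_def.2 fun v hv hv' ↦ ?_, ?_⟩
  · obtain ⟨l, hl, w, hw, rfl⟩ := Submodule.mem_sup.1 hv'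
    have := L.independent x (neg_mem hv) hl hw (by abel)
    simp [this.2]
  · rw [codisjoint_iff, ← sup_assoc, L.sup_eq_top x]

theorem isCompl_screenTr (x : M) : IsCompl (L.screenTr x) (tangent (m := m) φ x ⊔ L.ltr x) := by
  refine ⟨Submodule.disjoint_def.2 fun v hv hv' ↦ ?_, ?_⟩
  · obtain ⟨a, ha, l, hl, rfl⟩ := Submodule.mem_sup.1 hv'
    have := L.independent x ha hl (neg_mem hv) (by abel)
    simp [this.1, this.2.1]
  · rw [codisjoint_iff, sup_comm, L.sup_eq_top x]

/-- The tangential component, for the decomposition `TN = TM ⊕ ltr(TM) ⊕ S(TMᗮ)` along `M`. -/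
def tangentPart (x : M) : TangentSpace (𝓡 d) (φ x) →ₗ[ℝ] TangentSpace (𝓡 d) (φ x) :=
  (tangent (m := m) φ x).projection _ (L.isCompl_tangent x)

/-- The component in `S(TMᗮ)`, for the decomposition `TN = TM ⊕ ltr(TM) ⊕ S(TMᗮ)` along `M`. -/
def screenTrPart (x : M) : TangentSpace (𝓡 d) (φ x) →ₗ[ℝ] TangentSpace (𝓡 d) (φ x) :=
  (L.screenTr x).projection _ (L.isCompl_screenTr x)

variable (D : CovariantDerivative (𝓡 d) (EuclideanSpace ℝ (Fin d))
  (TangentSpace (𝓡 d) : N → Type _))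

/-- The connection induced on `M` by a connection of `N`: the tangential component of the
derivative of `V` in the direction `U`, for vector fields `U`, `V` on `M`. -/
def inducedConnection (U V : (x : M) → TangentSpace (𝓡 m) x) (x : M) :
    TangentSpace (𝓡 d) (φ x) :=
  L.tangentPart x (covAlong D φ U (push φ V) x)

/-- The screen second fundamental form `hˢ(U, Y)`: the `S(TMᗮ)`-component of the derivative, in
the direction of the vector field `U` on `M`, of a vector field `Y` tangent to `M` (given as a
vector field along `φ`). -/
def hs (U : (x : M) → TangentSpace (𝓡 m) x) (Y : (x : M) → TangentSpace (𝓡 d) (φ x)) (x : M) :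
    TangentSpace (𝓡 d) (φ x) :=
  L.screenTrPart x (covAlong D φ U Y x)

/-- The form `Dˢ(U, ν)`: the `S(TMᗮ)`-component of the derivative, in the direction of the vector
field `U` on `M`, of a section `ν` of `ltr(TM)`. -/
def Ds (U : (x : M) → TangentSpace (𝓡 m) x) (ν : (x : M) → TangentSpace (𝓡 d) (φ x)) (x : M) :
    TangentSpace (𝓡 d) (φ x) :=
  L.screenTrPart x (covAlong D φ U ν x)

/-- A distribution `F` on `M` defines a totally geodesic foliation on `M` with respect to the
connection induced by `D`: `D_U V` is a section of `F` for all sections `U`, `V` of `F`. -/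
def DefinesTotallyGeodesicFoliation
    (F : (x : M) → Submodule ℝ (TangentSpace (𝓡 d) (φ x))) : Prop :=
  ∀ U V : (x : M) → TangentSpace (𝓡 m) x, IsTangentSection φ F U → IsTangentSection φ F V →
    ∀ x, L.inducedConnection D U V x ∈ F x

/-- The orthogonal complement `Bᗮ` of `B` in `S(TM)`. -/
def screenOrth (B : (x : M) → Submodule ℝ (TangentSpace (𝓡 d) (φ x))) (x : M) :
    Submodule ℝ (TangentSpace (𝓡 d) (φ x)) :=
  L.screen x ⊓ g.orth (φ x) (B x)

/-- `M` is a screen semi-invariant lightlike submanifold of the metallic semi-Riemannian manifold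
`N`, with invariant distribution `B ⊆ S(TM)`. -/
structure IsScreenSemiInvariant {p q : ℕ} (S : g.MetallicStructure p q)
    (B : (x : M) → Submodule ℝ (TangentSpace (𝓡 d) (φ x))) : Prop where
  isSubbundle : ∃ k, IsSubbundleAlong (m := m) φ B k
  le_screen (x : M) : B x ≤ L.screen x
  inf_orth (x : M) : B x ⊓ L.screenOrth B x = ⊥
  sup_orth (x : M) : B x ⊔ L.screenOrth B x = L.screen x
  map_B (x : M) : (B x).map (S.J (φ x)).toLinearMap = B x
  map_orth (x : M) : (L.screenOrth B x).map (S.J (φ x)).toLinearMap ≤ L.screenTr x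
  map_radical (x : M) : (g.radical (m := m) φ x).map (S.J (φ x)).toLinearMap =
    g.radical (m := m) φ x
  map_ltr (x : M) : (L.ltr x).map (S.J (φ x)).toLinearMap = L.ltr x

end LightlikeSubmanifold

end Along

end LightlikeGeometry

end

open LightlikeGeometry

/-!
Let `E` be one of the bundles `B` and `ltr(TM)`. It is invariant under `J` and orthogonal to
`S(TMᗮ)`, which contains `J U` and `J V` for sections `U`, `V` of `Bᗮ`. For a section `Z` of `E`
the fields `J Z` and `J V` are therefore orthogonal, and since `∇` is metric and `J` is parallel
along `M` and self-adjoint,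

  `g(∇_U (J Z), J V) = -g(J Z, ∇_U (J V)) = -g(J Z, J ∇_U V) = -g(J² Z, ∇_U V)`.

Passing from `∇` to the quarter symmetric connection adds the term `π(J Z) g(J U, J V)`, and taking
the `S(TMᗮ)`-component does not change the product with `J V ∈ S(TMᗮ)`. So the identity for `E`
says that `∇_U V` is orthogonal to `J² Z` for all sections `Z` of `E`. As `J` maps `E` onto `E`, and
every vector of `E` extends to a global section, this means that `∇_U V` is orthogonal to `E`
(`forall_inner_screenTrPart_iff`).

On the other hand, a tangent vector lies in `Bᗮ` if and only if it is orthogonal to `B` and to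
`ltr(TM)` (`mem_screenOrth_iff`), because `ltr(TM)` detects the radical component. The difference
of the induced derivative of `V` from `∇_U V` lies in `ltr(TM) ⊕ S(TMᗮ)`, which is orthogonal to
both `B` and `ltr(TM)`, so `Bᗮ` is totally geodesic if and only if `∇_U V` is orthogonal to `B` and to
`ltr(TM)` (`definesTotallyGeodesicFoliation_screenOrth_iff`).

The analytic ingredient is the compatibility of the pull-back connection with the metric
(`covAlong_metric`).
-/

/-! ### The metric property along a map -/

/-- The product rule for a field of continuous linear maps applied to a vector-valued function. -/
theorem mvfderiv_clm_apply {E H M F F' : Type*} [NormedAddCommGroup E] [NormedSpace ℝ E]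
    [TopologicalSpace H] {I : ModelWithCorners ℝ E H} [TopologicalSpace M] [ChartedSpace H M]
    [NormedAddCommGroup F] [NormedSpace ℝ F] [NormedAddCommGroup F'] [NormedSpace ℝ F']
    {A : M → F →L[ℝ] F'} {u : M → F} {x : M}
    (hA : MDifferentiableAt I 𝓘(ℝ, F →L[ℝ] F') A x) (hu : MDifferentiableAt I 𝓘(ℝ, F) u x)
    (w : TangentSpace I x) :
    mvfderiv I (fun z ↦ A z (u z)) x w = A x (mvfderiv I u x w) + mvfderiv I A x w (u x) := by
  let A' : E →L[ℝ] F →L[ℝ] F' := mvfderiv I A x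
  let u' : E →L[ℝ] F := mvfderiv I u x
  have h : HasMFDerivAt I 𝓘(ℝ, F') (fun z ↦ A z (u z)) x ((A x).comp u' + A'.flip (u x)) := by
    refine ⟨hA.continuousAt.clm_apply hu.continuousAt, ?_⟩
    have h1 := hA.hasMFDerivAt.2.clm_apply hu.hasMFDerivAt.2
    convert! h1 using 1
    simp [writtenInExtChartAt, A', u']
    rfl
  exact congrArg (fun T : E →L[ℝ] F' ↦ T w) h.mfderiv

theorem Filter.EventuallyEq.mvfderiv_eq {E H M F : Type*} [NormedAddCommGroup E] [NormedSpace ℝ E]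
    [TopologicalSpace H] {I : ModelWithCorners ℝ E H} [TopologicalSpace M] [ChartedSpace H M]
    [NormedAddCommGroup F] [NormedSpace ℝ F] {f f' : M → F} {x : M} (h : f =ᶠ[𝓝 x] f') :
    mvfderiv I f x = mvfderiv I f' x := by
  ext v
  exact congrArg (fun T : E →L[ℝ] F ↦ T v) h.mfderiv_eq

section
variable {m d : ℕ} {N : Type*} [TopologicalSpace N]
  [ChartedSpace (EuclideanSpace ℝ (Fin d)) N] [IsManifold (𝓡 d) ∞ N]
  {M : Type*} [TopologicalSpace M]
  [ChartedSpace (EuclideanSpace ℝ (Fin m)) M]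

namespace LightlikeGeometry

/-- The Levi-Civita connection is metric also along a differentiable map `φ`. In the trivialization
of `TN` around `φ x` the fields `X`, `Y` are vector-valued functions and the metric is a field of
bilinear forms; the product rule then splits off the derivative of the scalar product of the
fields with the constant coefficients of `X x`, `Y x`, to which the metric property on `N`
applies. -/
theorem covAlong_metric (g : SemiRiemannianMetric d N)
    {nabla : CovariantDerivative (𝓡 d) (EuclideanSpace ℝ (Fin d))
      (TangentSpace (𝓡 d) : N → Type _)} (hnabla : g.IsLeviCivita nabla)
    {φ : M → N} {x : M} (hφ : MDifferentiableAt (𝓡 m) (𝓡 d) φ x)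
    {X Y : (x : M) → TangentSpace (𝓡 d) (φ x)}
    (hX : MDifferentiableAt (𝓡 m) (𝓡 d).tangent
      (fun z ↦ (⟨φ z, X z⟩ : TangentBundle (𝓡 d) N)) x)
    (hY : MDifferentiableAt (𝓡 m) (𝓡 d).tangent
      (fun z ↦ (⟨φ z, Y z⟩ : TangentBundle (𝓡 d) N)) x)
    (U : (x : M) → TangentSpace (𝓡 m) x) :
    mvfderiv (𝓡 m) (fun z ↦ g.inner (φ z) (X z) (Y z)) x (U x) =
      g.inner (φ x) (covAlong nabla φ U X x) (Y x) +
        g.inner (φ x) (X x) (covAlong nabla φ U Y x) := by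
  set e := trivializationAt (EuclideanSpace ℝ (Fin d)) (TangentSpace (𝓡 d) : N → Type _) (φ x)
    with he
  let G : N → EuclideanSpace ℝ (Fin d) →L[ℝ] EuclideanSpace ℝ (Fin d) →L[ℝ] ℝ := fun y ↦
    ContinuousLinearMap.inCoordinates (EuclideanSpace ℝ (Fin d)) (TangentSpace (𝓡 d) : N → Type _)
      (EuclideanSpace ℝ (Fin d) →L[ℝ] ℝ) (fun y ↦ TangentSpace (𝓡 d) y →L[ℝ] ℝ)
      (φ x) y (φ x) y (g.inner y)
  have hG : MDifferentiableAt (𝓡 d)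
      𝓘(ℝ, EuclideanSpace ℝ (Fin d) →L[ℝ] EuclideanSpace ℝ (Fin d) →L[ℝ] ℝ) G (φ x) :=
    ((contMDiffAt_hom_bundle _).1 (g.contMDiff (φ x))).2.mdifferentiableAt (by simp)
  have hGe : ∀ y ∈ e.baseSet, ∀ u v, G y u v = g.inner y (e.symm y u) (e.symm y v) := by
    intro y hy u v
    have := inCoordinates_apply_eq₂ (𝕜 := ℝ) (F₁ := EuclideanSpace ℝ (Fin d))
      (F₂ := EuclideanSpace ℝ (Fin d)) (F₃ := ℝ) (E₁ := (TangentSpace (𝓡 d) : N → Type _))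
      (E₂ := (TangentSpace (𝓡 d) : N → Type _)) (E₃ := Bundle.Trivial N ℝ) (ϕ := g.inner y)
      (x₀ := φ x) (x := y) (v := u) (w := v) hy hy (by simp)
    refine this.trans ?_
    simp
    rfl
  have hx : φ x ∈ e.baseSet := FiberBundle.mem_baseSet_trivializationAt' (φ x)
  have hφe : ∀ᶠ z in 𝓝 x, φ z ∈ e.baseSet :=
    hφ.continuousAt.eventually_mem (e.open_baseSet.mem_nhds hx)
  have hX' := ((mdifferentiableAt_totalSpace _ _).1 hX).2
  have hY' := ((mdifferentiableAt_totalSpace _ _).1 hY).2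
  simp only [← he] at hX' hY'
  set X' : M → EuclideanSpace ℝ (Fin d) := fun z ↦ (e ⟨φ z, X z⟩).2 with hX'd
  set Y' : M → EuclideanSpace ℝ (Fin d) := fun z ↦ (e ⟨φ z, Y z⟩).2 with hY'd
  have hXs : ∀ z, φ z ∈ e.baseSet → e.symm (φ z) (X' z) = X z := fun z hz ↦
    e.symm_apply_apply_mk hz _
  have hYs : ∀ z, φ z ∈ e.baseSet → e.symm (φ z) (Y' z) = Y z := fun z hz ↦
    e.symm_apply_apply_mk hz _
  -- `h1`: the scalar product of `X`, `Y` in the local frame; `h2`: that of the fields with the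
  -- constant coefficients of `X x`, `Y x`, which are `FiberBundle.extend _ (X x)` and
  -- `FiberBundle.extend _ (Y x)`
  have h1 : (fun z ↦ g.inner (φ z) (X z) (Y z)) =ᶠ[𝓝 x] fun z ↦ G (φ z) (X' z) (Y' z) := by
    filter_upwards [hφe] with z hz
    rw [hGe _ hz, hXs z hz, hYs z hz]
  have h2 : (fun y ↦ g.inner y (FiberBundle.extend (EuclideanSpace ℝ (Fin d)) (X x) y)
      (FiberBundle.extend (EuclideanSpace ℝ (Fin d)) (Y x) y)) =ᶠ[𝓝 (φ x)]
      fun y ↦ G y (X' x) (Y' x) := by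
    filter_upwards [e.open_baseSet.mem_nhds hx] with y hy
    rw [hGe _ hy]
    rfl
  have hm := hnabla.metric (φ x) _ _
    (FiberBundle.mdifferentiableAt_extend (𝓡 d) (EuclideanSpace ℝ (Fin d)) (X x))
    (FiberBundle.mdifferentiableAt_extend (𝓡 d) (EuclideanSpace ℝ (Fin d)) (Y x))
    (mfderiv (𝓡 m) (𝓡 d) φ x (U x))
  have hGφ : MDifferentiableAt (𝓡 m)
      𝓘(ℝ, EuclideanSpace ℝ (Fin d) →L[ℝ] EuclideanSpace ℝ (Fin d) →L[ℝ] ℝ) (fun z ↦ G (φ z)) x :=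
    hG.comp x hφ
  have hconst (f : M → EuclideanSpace ℝ (Fin d) →L[ℝ] EuclideanSpace ℝ (Fin d) →L[ℝ] ℝ)
      (hf : MDifferentiableAt (𝓡 m)
        𝓘(ℝ, EuclideanSpace ℝ (Fin d) →L[ℝ] EuclideanSpace ℝ (Fin d) →L[ℝ] ℝ) f x)
      (u v : EuclideanSpace ℝ (Fin d)) (w : TangentSpace (𝓡 m) x) :
      mvfderiv (𝓡 m) (fun z ↦ f z u v) x w = mvfderiv (𝓡 m) f x w u v := by
    rw [mvfderiv_clm_apply (A := fun z ↦ f z u) (u := fun _ ↦ v)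
      (hf.clm_apply mdifferentiableAt_const) mdifferentiableAt_const,
      mvfderiv_clm_apply (A := f) (u := fun _ ↦ u) hf mdifferentiableAt_const]
    simp [mvfderiv_const]
  -- the metric property on `N`, for the two fields with constant coefficients
  have h3 : g.inner (φ x) (nabla (FiberBundle.extend (EuclideanSpace ℝ (Fin d)) (X x)) (φ x)
        (push φ U x)) (Y x) + g.inner (φ x) (X x)
        (nabla (FiberBundle.extend (EuclideanSpace ℝ (Fin d)) (Y x)) (φ x) (push φ U x)) =
      mvfderiv (𝓡 m) (fun z ↦ G (φ z)) x (U x) (X' x) (Y' x) := by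
    rw [← hconst _ hGφ]
    have h4 := mvfderiv_comp x (g := fun y ↦ G y (X' x) (Y' x)) (I := 𝓡 d) (f := φ)
      ((hG.clm_apply mdifferentiableAt_const).clm_apply mdifferentiableAt_const) hφ
    have h5 := congrArg (fun T : TangentSpace (𝓡 m) x →L[ℝ] ℝ ↦ T (U x)) h4
    rw [h2.mvfderiv_eq] at hm
    refine Eq.trans ?_ (hm.symm.trans h5.symm)
    simp [push]
  rw [h1.mvfderiv_eq, mvfderiv_clm_apply (A := fun z ↦ G (φ z) (X' z)) (hGφ.clm_apply hX') hY',
    mvfderiv_clm_apply hGφ hX']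
  simp only [add_apply, ← h3, covAlong, map_add]
  rw [hGe _ hx, hGe _ hx, hXs x hx, hYs x hx]
  ring

end LightlikeGeometry
end

/-! ### Vector fields along a map -/

section
variable {m d : ℕ} {N : Type*} [TopologicalSpace N]
  [ChartedSpace (EuclideanSpace ℝ (Fin d)) N] [IsManifold (𝓡 d) ∞ N]
  {M : Type*} [TopologicalSpace M]
  [ChartedSpace (EuclideanSpace ℝ (Fin m)) M]

namespace LightlikeGeometry

theorem covAlong_quarterSymmetric (g : SemiRiemannianMetric d N) {p q : ℕ}
    (S : g.MetallicStructure p q)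
    (nabla : CovariantDerivative (𝓡 d) (EuclideanSpace ℝ (Fin d))
      (TangentSpace (𝓡 d) : N → Type _)) (η : (y : N) → TangentSpace (𝓡 d) y)
    (φ : M → N) (U : (x : M) → TangentSpace (𝓡 m) x) (X : (x : M) → TangentSpace (𝓡 d) (φ x))
    (x : M) :
    covAlong (g.quarterSymmetric S nabla η) φ U X x =
      covAlong nabla φ U X x + g.oneForm η (φ x) (X x) • S.J (φ x) (push φ U x) := by
  have h : g.quarterSymmetric S nabla η
      (FiberBundle.extend (EuclideanSpace ℝ (Fin d)) (X x)) (φ x) (push φ U x) =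
      nabla (FiberBundle.extend (EuclideanSpace ℝ (Fin d)) (X x)) (φ x) (push φ U x) +
        g.oneForm η (φ x) (FiberBundle.extend (EuclideanSpace ℝ (Fin d)) (X x) (φ x)) •
          S.J (φ x) (push φ U x) := rfl
  rw [FiberBundle.extend_apply_self] at h
  rw [covAlong, h, covAlong, add_assoc]

theorem IsSmoothAlong.mdifferentiableAt {φ : M → N} {X : (x : M) → TangentSpace (𝓡 d) (φ x)}
    (hX : IsSmoothAlong (m := m) φ X) (x : M) :
    MDifferentiableAt (𝓡 m) (𝓡 d).tangent
      (fun z ↦ (⟨φ z, X z⟩ : TangentBundle (𝓡 d) N)) x :=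
  (hX x).mdifferentiableAt (by simp)

theorem IsSmoothVectorField.push_along [IsManifold (𝓡 m) ∞ M] {φ : M → N}
    {V : (x : M) → TangentSpace (𝓡 m) x}
    (hV : IsSmoothVectorField (d := m) V) (hφ : ContMDiff (𝓡 m) (𝓡 d) ∞ φ) :
    IsSmoothAlong (m := m) φ (push (d := d) φ V) := by
  have : IsManifold (𝓡 m) 1 M := .of_le (n := ∞) (by simp)
  have : IsManifold (𝓡 d) 1 N := .of_le (n := ∞) (by simp)
  exact (hφ.contMDiff_tangentMap (m := ∞) (by simp)).comp hV

theorem IsSmoothAlong.endomorphismField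
    {J : (y : N) → TangentSpace (𝓡 d) y →L[ℝ] TangentSpace (𝓡 d) y}
    (hJ : IsSmoothEndomorphismField J) {φ : M → N}
    (hφ : ContMDiff (𝓡 m) (𝓡 d) ∞ φ) {X : (x : M) → TangentSpace (𝓡 d) (φ x)}
    (hX : IsSmoothAlong (m := m) φ X) :
    IsSmoothAlong (m := m) φ (fun z ↦ J (φ z) (X z)) :=
  ContMDiff.clm_bundle_apply (F₁ := EuclideanSpace ℝ (Fin d)) (F₂ := EuclideanSpace ℝ (Fin d))
    (E₁ := (TangentSpace (𝓡 d) : N → Type _)) (E₂ := (TangentSpace (𝓡 d) : N → Type _))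
    (hJ.comp hφ) hX

/-- Smoothness is read off in the trivialization of `TN` around `φ x`, which is linear on fibres. -/
theorem contMDiffAt_sum_smul_along {ι : Type*} [Fintype ι] {φ : M → N} {x : M}
    (hφ : ContMDiffAt (𝓡 m) (𝓡 d) ∞ φ x) {f : ι → M → ℝ}
    (hf : ∀ i, ContMDiffAt (𝓡 m) 𝓘(ℝ, ℝ) ∞ (f i) x)
    {e : ι → (x : M) → TangentSpace (𝓡 d) (φ x)}
    (he : ∀ i, ContMDiffAt (𝓡 m) (𝓡 d).tangent ∞
      (fun z ↦ (⟨φ z, e i z⟩ : TangentBundle (𝓡 d) N)) x) :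
    ContMDiffAt (𝓡 m) (𝓡 d).tangent ∞
      (fun z ↦ (⟨φ z, ∑ i, f i z • e i z⟩ : TangentBundle (𝓡 d) N)) x := by
  refine contMDiffAt_totalSpace.2 ⟨hφ, ?_⟩
  have h : ContMDiffAt (𝓡 m) 𝓘(ℝ, EuclideanSpace ℝ (Fin d)) ∞ (fun z ↦ ∑ i, f i z •
      (trivializationAt (EuclideanSpace ℝ (Fin d)) (TangentSpace (𝓡 d) : N → Type _) (φ x)
        ⟨φ z, e i z⟩).2) x :=
    contMDiffAt_finsetSum fun i _ ↦ (hf i).smul (contMDiffAt_totalSpace.1 (he i)).2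
  refine h.congr_of_eventuallyEq ?_
  filter_upwards [hφ.continuousAt.eventually_mem
    ((trivializationAt (EuclideanSpace ℝ (Fin d)) (TangentSpace (𝓡 d) : N → Type _)
      (φ x)).open_baseSet.mem_nhds (FiberBundle.mem_baseSet_trivializationAt' (φ x)))] with z hz
  have hl := Trivialization.coe_linearMapAt_of_mem (R := ℝ) (trivializationAt
    (EuclideanSpace ℝ (Fin d)) (TangentSpace (𝓡 d) : N → Type _) (φ x)) hz
  have hl' := fun v ↦ (congrFun hl v).symm
  simp only at hl'
  simp only [hl', map_sum, map_smul]

/-- A vector of a smooth subbundle extends to a global section: its combination with constant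
coefficients of a local frame is cut off by a bump function. -/
theorem IsSubbundleAlong.exists_isSection_eq [T2Space M] [IsManifold (𝓡 m) ∞ M] {φ : M → N}
    (hφ : ContMDiff (𝓡 m) (𝓡 d) ∞ φ)
    {E : (x : M) → Submodule ℝ (TangentSpace (𝓡 d) (φ x))} {k : ℕ}
    (hE : IsSubbundleAlong (m := m) φ E k) {x : M} {v : TangentSpace (𝓡 d) (φ x)} (hv : v ∈ E x) :
    ∃ Z, IsSection (m := m) φ E Z ∧ Z x = v := by
  obtain ⟨W, hW, e, he, hspan⟩ := hE x
  obtain ⟨f, -, hf⟩ := (SmoothBumpFunction.nhds_basis_tsupport (I := 𝓡 m) x).mem_iff.1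
    (interior_mem_nhds.2 hW)
  have hv' : v ∈ Submodule.span ℝ (Set.range fun i ↦ e i x) :=
    (hspan x (mem_of_mem_nhds hW)).2 ▸ hv
  obtain ⟨c, rfl⟩ := (Submodule.mem_span_range_iff_exists_fun ℝ).1 hv'
  refine ⟨fun z ↦ ∑ i, (f z * c i) • e i z, ⟨fun z ↦ ?_, fun z ↦ ?_⟩, ?_⟩
  · by_cases hz : z ∈ tsupport f
    · exact contMDiffAt_sum_smul_along (hφ z)
        (fun i ↦ f.contMDiff.contMDiffAt.mul contMDiffAt_const)
        fun i ↦ (he i).contMDiffAt (mem_interior_iff_mem_nhds.1 (hf hz))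
    · have h0 := ((contMDiff_zeroSection (n := ∞) (IB := 𝓡 d) (F := EuclideanSpace ℝ (Fin d)) ℝ
        (TangentSpace (𝓡 d) : N → Type _)).comp hφ) z
      refine h0.congr_of_eventuallyEq ?_
      filter_upwards [notMem_tsupport_iff_eventuallyEq.1 hz] with y hy
      simp [hy, zeroSection]
  · by_cases hz : z ∈ tsupport f
    · rw [← (hspan z (interior_subset (hf hz))).2]
      exact sum_mem fun i _ ↦ Submodule.smul_mem _ _ (Submodule.subset_span ⟨i, rfl⟩)
    · simp [image_eq_zero_of_notMem_tsupport hz]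
  · simp

end LightlikeGeometry
end

/-! ### Orthogonality in the decomposition along a lightlike submanifold -/

section Pointwise
variable {m d : ℕ} {N : Type*} [TopologicalSpace N]
  [ChartedSpace (EuclideanSpace ℝ (Fin d)) N] [IsManifold (𝓡 d) ∞ N]
  {M : Type*} [TopologicalSpace M]
  [ChartedSpace (EuclideanSpace ℝ (Fin m)) M]
  {g : SemiRiemannianMetric d N} {φ : M → N}
  (L : LightlikeSubmanifold (m := m) g φ)
namespace LightlikeGeometry.LightlikeSubmanifold

theorem screen_le_tangent (x : M) : L.screen x ≤ tangent (m := m) φ x :=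
  le_sup_left.trans (L.screen_sup x).le

theorem screenTr_le_orth_tangent (x : M) :
    L.screenTr x ≤ g.orth (φ x) (tangent (m := m) φ x) :=
  le_sup_left.trans (L.screenTr_sup x).le

theorem ltr_le_orth (x : M) :
    L.ltr x ≤ g.orth (φ x) (L.screen x) ⊓ g.orth (φ x) (L.screenTr x) :=
  le_sup_left.trans (L.ltr_sup x).le

theorem screen_le_orth_ltr (x : M) : L.screen x ≤ g.orth (φ x) (L.ltr x) := fun v hv l hl ↦ by
  rw [g.symm]; exact (L.ltr_le_orth x hl).1 v hv

theorem screen_le_orth_screenTr (x : M) : L.screen x ≤ g.orth (φ x) (L.screenTr x) :=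
  fun v hv s hs ↦ by
    rw [g.symm]; exact L.screenTr_le_orth_tangent x hs v (L.screen_le_tangent x hv)

variable [IsManifold (𝓡 m) ∞ M]

theorem inner_screenTrPart (x : M) (w : TangentSpace (𝓡 d) (φ x)) {s : TangentSpace (𝓡 d) (φ x)}
    (hs : s ∈ L.screenTr x) : g.inner (φ x) (L.screenTrPart x w) s = g.inner (φ x) w s := by
  have h : w - L.screenTrPart x w ∈ tangent (m := m) φ x ⊔ L.ltr x :=
    Submodule.sub_projection_mem (L.isCompl_screenTr x) w
  obtain ⟨t, ht, l, hl, h⟩ := Submodule.mem_sup.1 h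
  have h1 : g.inner (φ x) t s = 0 := by
    rw [g.symm]; exact L.screenTr_le_orth_tangent x hs t ht
  have h2 : g.inner (φ x) l s = 0 := (L.ltr_le_orth x hl).2 s hs
  have h3 := congrArg (fun u ↦ g.inner (φ x) u s) h
  simp [h1, h2] at h3
  linarith

theorem inner_tangentPart (x : M) (w : TangentSpace (𝓡 d) (φ x)) {v : TangentSpace (𝓡 d) (φ x)}
    (hl : v ∈ g.orth (φ x) (L.ltr x)) (hs : v ∈ g.orth (φ x) (L.screenTr x)) :
    g.inner (φ x) (L.tangentPart x w) v = g.inner (φ x) w v := by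
  have h : w - L.tangentPart x w ∈ L.ltr x ⊔ L.screenTr x :=
    Submodule.sub_projection_mem (L.isCompl_tangent x) w
  obtain ⟨l, hl', s, hs', h⟩ := Submodule.mem_sup.1 h
  have h1 := hl l hl'
  have h2 := hs s hs'
  rw [g.symm] at h1 h2
  have h3 := congrArg (fun u ↦ g.inner (φ x) u v) h
  simp [h1, h2] at h3
  linarith

/-- The radical is orthogonal to `TM` and to `S(TMᗮ)`, so by nondegeneracy a radical vector that is
also orthogonal to `ltr(TM)` vanishes. -/
theorem eq_zero_of_mem_radical (x : M) {e : TangentSpace (𝓡 d) (φ x)}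
    (he : e ∈ g.radical (m := m) φ x) (h : ∀ l ∈ L.ltr x, g.inner (φ x) e l = 0) : e = 0 := by
  refine g.nondegenerate (φ x) e fun w ↦ ?_
  have hw : w ∈ tangent (m := m) φ x ⊔ L.ltr x ⊔ L.screenTr x := L.sup_eq_top x ▸ Submodule.mem_top
  obtain ⟨u, hu, s, hs, rfl⟩ := Submodule.mem_sup.1 hw
  obtain ⟨t, ht, l, hl, rfl⟩ := Submodule.mem_sup.1 hu
  have h1 := he.2 t ht
  have h2 := L.screenTr_le_orth_tangent x hs e he.1
  rw [g.symm] at h2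
  simp [h1, h2, h l hl]

/-- A tangent vector orthogonal to `ltr(TM)` has no radical component, hence lies in the screen;
there `Bᗮ` is cut out by orthogonality to `B`. -/
theorem mem_screenOrth_iff
    (B : (x : M) → Submodule ℝ (TangentSpace (𝓡 d) (φ x))) (x : M)
    {t : TangentSpace (𝓡 d) (φ x)} (ht : t ∈ tangent (m := m) φ x) :
    t ∈ L.screenOrth B x ↔
      (∀ b ∈ B x, g.inner (φ x) t b = 0) ∧ ∀ l ∈ L.ltr x, g.inner (φ x) t l = 0 := by
  refine ⟨fun h ↦ ⟨h.2, L.screen_le_orth_ltr x h.1⟩, fun ⟨hb, hl⟩ ↦ ?_⟩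
  rw [← L.screen_sup x] at ht
  obtain ⟨s, hs, e, he, rfl⟩ := Submodule.mem_sup.1 ht
  have he0 : e = 0 := L.eq_zero_of_mem_radical x he fun l hl' ↦ by
    have h1 := hl l hl'
    have h2 := L.screen_le_orth_ltr x hs l hl'
    simpa [h2] using h1
  subst he0
  exact ⟨by simpa using hs, hb⟩

end LightlikeGeometry.LightlikeSubmanifold
end Pointwise

/-! ### Sections of `Bᗮ` -/

section
variable {m d : ℕ} {N : Type*} [TopologicalSpace N]
  [ChartedSpace (EuclideanSpace ℝ (Fin d)) N] [IsManifold (𝓡 d) ∞ N]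
  {M : Type*} [TopologicalSpace M]
  [ChartedSpace (EuclideanSpace ℝ (Fin m)) M] [IsManifold (𝓡 m) ∞ M]
  {g : SemiRiemannianMetric d N} {φ : M → N}
  {nabla : CovariantDerivative (𝓡 d) (EuclideanSpace ℝ (Fin d))
      (TangentSpace (𝓡 d) : N → Type _)}
  {p q : ℕ} {S : g.MetallicStructure p q}

namespace LightlikeGeometry

omit [IsManifold (𝓡 m) ∞ M] in
theorem inner_covAlong_eq_neg_of_inner_eq_zero (hnabla : g.IsLeviCivita nabla)
    (hφ : ContMDiff (𝓡 m) (𝓡 d) ∞ φ) {X Y : (x : M) → TangentSpace (𝓡 d) (φ x)}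
    (hX : IsSmoothAlong (m := m) φ X) (hY : IsSmoothAlong (m := m) φ Y)
    (hXY : ∀ x, g.inner (φ x) (X x) (Y x) = 0) (U : (x : M) → TangentSpace (𝓡 m) x) (x : M) :
    g.inner (φ x) (covAlong nabla φ U X x) (Y x) =
      -g.inner (φ x) (X x) (covAlong nabla φ U Y x) := by
  have h := covAlong_metric g hnabla ((hφ x).mdifferentiableAt (by simp))
    (hX.mdifferentiableAt x) (hY.mdifferentiableAt x) U
  simp only [hXY, mvfderiv_const] at h
  simp at h
  linarith

/-- If `J` is parallel along `M` and `J Z` is orthogonal to `J V`, with `V` tangent to `M`, moving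
the derivative from `J Z` to `J V` gives `g(∇_U (J Z), J V) = -g(∇_U V, J² Z)`. -/
theorem inner_covAlong_J_J (hnabla : g.IsLeviCivita nabla) (hφ : ContMDiff (𝓡 m) (𝓡 d) ∞ φ)
    (hJ : S.IsParallelAlong (m := m) nabla φ)
    {U V : (x : M) → TangentSpace (𝓡 m) x} (hU : IsSmoothVectorField U)
    (hV : IsSmoothVectorField V) {Z : (x : M) → TangentSpace (𝓡 d) (φ x)}
    (hZ : IsSmoothAlong (m := m) φ Z)
    (hZV : ∀ x, g.inner (φ x) (S.J (φ x) (Z x)) (S.J (φ x) (push φ V x)) = 0) (x : M) :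
    g.inner (φ x) (covAlong nabla φ U (fun z ↦ S.J (φ z) (Z z)) x) (S.J (φ x) (push φ V x)) =
      -g.inner (φ x) (covAlong nabla φ U (push φ V) x) (S.J (φ x) (S.J (φ x) (Z x))) := by
  rw [inner_covAlong_eq_neg_of_inner_eq_zero hnabla hφ (hZ.endomorphismField S.smooth hφ)
    ((hV.push_along hφ).endomorphismField S.smooth hφ) hZV U x, hJ U V hU hV x, S.compatible,
    g.symm]

variable {L : LightlikeSubmanifold (m := m) g φ}
  {B : (x : M) → Submodule ℝ (TangentSpace (𝓡 d) (φ x))}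

namespace LightlikeSubmanifold

/-- For an invariant subbundle `E` orthogonal to `S(TMᗮ)`, the identity for the
`S(TMᗮ)`-components of the derivatives of `J Z`, `Z` a section of `E`, says that `∇_U V` is
orthogonal to `E`, because every vector of `E` is `J² Z` for a section `Z` of `E`. -/
theorem IsScreenSemiInvariant.forall_inner_screenTrPart_iff [T2Space M]
    (hB : L.IsScreenSemiInvariant S B) (hnabla : g.IsLeviCivita nabla)
    (hJ : S.IsParallelAlong (m := m) nabla φ) (η : (y : N) → TangentSpace (𝓡 d) y)
    {E : (x : M) → Submodule ℝ (TangentSpace (𝓡 d) (φ x))} {k : ℕ}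
    (hE : IsSubbundleAlong (m := m) φ E k)
    (hJE : ∀ x, (E x).map (S.J (φ x)).toLinearMap = E x)
    (hEs : ∀ x, E x ≤ g.orth (φ x) (L.screenTr x)) :
    (∀ U V : (x : M) → TangentSpace (𝓡 m) x,
        IsTangentSection φ (L.screenOrth B) U → IsTangentSection φ (L.screenOrth B) V →
        ∀ Z : (x : M) → TangentSpace (𝓡 d) (φ x), IsSection (m := m) φ E Z → ∀ x : M,
          g.inner (φ x) (L.screenTrPart x
              (covAlong (g.quarterSymmetric S nabla η) φ U (fun z ↦ S.J (φ z) (Z z)) x))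
              (S.J (φ x) (push φ V x)) =
            g.oneForm η (φ x) (S.J (φ x) (Z x)) *
              g.inner (φ x) (S.J (φ x) (push φ U x)) (S.J (φ x) (push φ V x))) ↔
      ∀ U V : (x : M) → TangentSpace (𝓡 m) x,
        IsTangentSection φ (L.screenOrth B) U → IsTangentSection φ (L.screenOrth B) V →
        ∀ x, ∀ e ∈ E x, g.inner (φ x) (covAlong nabla φ U (push φ V) x) e = 0 := by
  have hφ := L.isImmersion.contMDiff
  have hJmem : ∀ x, ∀ e ∈ E x, S.J (φ x) e ∈ E x := fun x e he ↦
    (hJE x).le (Submodule.mem_map_of_mem he)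
  have hJV : ∀ x, ∀ v ∈ L.screenOrth B x, S.J (φ x) v ∈ L.screenTr x := fun x v hv ↦
    hB.map_orth x (Submodule.mem_map_of_mem hv)
  have key : ∀ {U V : (x : M) → TangentSpace (𝓡 m) x},
      IsTangentSection φ (L.screenOrth B) U → IsTangentSection φ (L.screenOrth B) V →
      ∀ {Z : (x : M) → TangentSpace (𝓡 d) (φ x)}, IsSection (m := m) φ E Z → ∀ x : M,
      g.inner (φ x) (L.screenTrPart x
              (covAlong (g.quarterSymmetric S nabla η) φ U (fun z ↦ S.J (φ z) (Z z)) x))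
              (S.J (φ x) (push φ V x)) =
        -g.inner (φ x) (covAlong nabla φ U (push φ V) x) (S.J (φ x) (S.J (φ x) (Z x))) +
        g.oneForm η (φ x) (S.J (φ x) (Z x)) *
          g.inner (φ x) (S.J (φ x) (push φ U x)) (S.J (φ x) (push φ V x)) := by
    intro U V hU hV Z hZ x
    rw [L.inner_screenTrPart x _ (hJV x _ (hV.2 x)), covAlong_quarterSymmetric, map_add,
      add_apply, inner_covAlong_J_J hnabla hφ hJ hU.1 hV.1 hZ.1
        fun z ↦ hEs z (hJmem z _ (hZ.2 z)) _ (hJV z _ (hV.2 z))]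
    simp
  constructor
  -- write `e = J² (Z x)`, so that the identity for `Z` is the orthogonality of `∇_U V` and `e`
  · intro h U V hU hV x e he
    rw [← hJE x] at he
    obtain ⟨e₁, he₁, rfl⟩ := he
    rw [← hJE x] at he₁
    obtain ⟨e₂, he₂, rfl⟩ := he₁
    obtain ⟨Z, hZ, rfl⟩ := hE.exists_isSection_eq hφ he₂
    have h1 := h U V hU hV Z hZ x
    rw [key hU hV hZ x] at h1
    simpa using h1
  · intro h U V hU hV Z hZ x
    rw [key hU hV hZ x, h U V hU hV x _ (hJmem x _ (hJmem x _ (hZ.2 x)))]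
    simp

/-- `Bᗮ` is totally geodesic for the induced connection exactly when the Levi-Civita derivatives
`∇_U V` of its sections are orthogonal to `B` and to `ltr(TM)`: the term `π(V) J U` by which the
connections differ lies in `S(TMᗮ)`. -/
theorem IsScreenSemiInvariant.definesTotallyGeodesicFoliation_screenOrth_iff
    (hB : L.IsScreenSemiInvariant S B) (η : (y : N) → TangentSpace (𝓡 d) y) :
    L.DefinesTotallyGeodesicFoliation (g.quarterSymmetric S nabla η) (L.screenOrth B) ↔
      ∀ U V : (x : M) → TangentSpace (𝓡 m) x,
        IsTangentSection φ (L.screenOrth B) U → IsTangentSection φ (L.screenOrth B) V →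
        ∀ x, (∀ b ∈ B x, g.inner (φ x) (covAlong nabla φ U (push φ V) x) b = 0) ∧
          ∀ l ∈ L.ltr x, g.inner (φ x) (covAlong nabla φ U (push φ V) x) l = 0 := by
  refine forall₄_congr fun U V hU hV ↦ forall_congr' fun x ↦ ?_
  have key : ∀ v ∈ g.orth (φ x) (L.ltr x) ⊓ g.orth (φ x) (L.screenTr x),
      g.inner (φ x) (L.inducedConnection (g.quarterSymmetric S nabla η) U V x) v =
        g.inner (φ x) (covAlong nabla φ U (push φ V) x) v := by
    intro v hv
    have hJU : g.inner (φ x) (S.J (φ x) (push φ U x)) v = 0 := by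
      rw [g.symm]
      exact hv.2 _ (hB.map_orth x (Submodule.mem_map_of_mem (hU.2 x)))
    rw [inducedConnection, L.inner_tangentPart x _ hv.1 hv.2, covAlong_quarterSymmetric]
    simp [hJU]
  have ht : L.inducedConnection (g.quarterSymmetric S nabla η) U V x ∈ tangent (m := m) φ x :=
    Submodule.projection_apply_mem (L.isCompl_tangent x) _
  rw [L.mem_screenOrth_iff B x ht]
  exact and_congr
    (forall₂_congr fun b hb ↦ by
      rw [key b ⟨L.screen_le_orth_ltr x (hB.le_screen x hb),
        L.screen_le_orth_screenTr x (hB.le_screen x hb)⟩])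
    (forall₂_congr fun l hl ↦ by rw [key l ⟨L.ltr_null x l hl, (L.ltr_le_orth x hl).2⟩])

end LightlikeSubmanifold
end LightlikeGeometry
end

theorem mainTheorem12 {m n : ℕ}
    {N : Type*} [TopologicalSpace N] [T2Space N] [SecondCountableTopology N]
    [ChartedSpace (EuclideanSpace ℝ (Fin (m + n))) N] [IsManifold (𝓡 (m + n)) ∞ N]
    {M : Type*} [TopologicalSpace M] [T2Space M] [SecondCountableTopology M]
    [ChartedSpace (EuclideanSpace ℝ (Fin m)) M] [IsManifold (𝓡 m) ∞ M]
    (g : SemiRiemannianMetric (m + n) N)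
    {p q : ℕ} (S : g.MetallicStructure p q)
    (nabla : CovariantDerivative (𝓡 (m + n)) (EuclideanSpace ℝ (Fin (m + n)))
      (TangentSpace (𝓡 (m + n)) : N → Type _))
    (hnabla : g.IsLeviCivita nabla)
    (η : (y : N) → TangentSpace (𝓡 (m + n)) y) (hη : IsSmoothVectorField η)
    (φ : M → N) (L : LightlikeSubmanifold (m := m) g φ)
    (hJ : S.IsParallelAlong (m := m) nabla φ)
    (B : (x : M) → Submodule ℝ (TangentSpace (𝓡 (m + n)) (φ x)))
    (hB : L.IsScreenSemiInvariant S B) :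
    L.DefinesTotallyGeodesicFoliation (g.quarterSymmetric S nabla η) (L.screenOrth B) ↔
      (∀ U V : (x : M) → TangentSpace (𝓡 m) x,
        IsTangentSection φ (L.screenOrth B) U →
        IsTangentSection φ (L.screenOrth B) V →
        ∀ Z : (x : M) → TangentSpace (𝓡 (m + n)) (φ x),
        IsSection (m := m) φ B Z → ∀ x : M,
          g.inner (φ x)
              (L.hs (g.quarterSymmetric S nabla η) U (fun z ↦ S.J (φ z) (Z z)) x)
              (S.J (φ x) (push φ V x)) =
            g.oneForm η (φ x) (S.J (φ x) (Z x)) *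
              g.inner (φ x) (S.J (φ x) (push φ U x))
                (S.J (φ x) (push φ V x))) ∧
      (∀ U V : (x : M) → TangentSpace (𝓡 m) x,
        IsTangentSection φ (L.screenOrth B) U →
        IsTangentSection φ (L.screenOrth B) V →
        ∀ ν : (x : M) → TangentSpace (𝓡 (m + n)) (φ x),
        IsSection (m := m) φ L.ltr ν → ∀ x : M,
          g.inner (φ x)
              (L.Ds (g.quarterSymmetric S nabla η) U (fun z ↦ S.J (φ z) (ν z)) x)
              (S.J (φ x) (push φ V x)) =
            g.oneForm η (φ x) (S.J (φ x) (ν x)) *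
              g.inner (φ x) (S.J (φ x) (push φ U x))
                (S.J (φ x) (push φ V x))) := by
  obtain ⟨k, hk⟩ := hB.isSubbundle
  rw [hB.definesTotallyGeodesicFoliation_screenOrth_iff η]
  refine Iff.trans ?_ (and_congr
    (hB.forall_inner_screenTrPart_iff hnabla hJ η hk hB.map_B fun x ↦
      (hB.le_screen x).trans (L.screen_le_orth_screenTr x))
    (hB.forall_inner_screenTrPart_iff hnabla hJ η L.isSubbundle_ltr hB.map_ltr fun x ↦
      (L.ltr_le_orth x).trans inf_le_right)).symm
  exact ⟨fun h ↦ ⟨fun U V hU hV x ↦ (h U V hU hV x).1, fun U V hU hV x ↦ (h U V hU hV x).2⟩,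
    fun h U V hU hV x ↦ ⟨h.1 U V hU hV x, h.2 U V hU hV x⟩⟩
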